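/- Let $n\in\mathbb N$, $p\in(1,n]$ (so $n\ge 2$), $x_0\in\mathbb R^n$. For $\Omega\subset\mathbb R^n$ let $C_0^\infty(\Omega)$ be the set of smooth real functions on $\mathbb R^n$ whose support is compact and contained in $\Omega$. For compact $K\subset\Omega$ put $$cap_p(K,\Omega)=\inf\Big\{\int_\Omega|\nabla u|^p\,dx:\ u\in C_0^\infty(\Omega),\ u\ge 1\text{ on }K\Big\}\qquad(\inf\emptyset=+\infty),$$ and for arbitrary $E\subset\Omega$ put $$cap_p(E,\Omega)=\inf_{G\text{ open},\ E\subset G\subset\Omega}\ \ \sup_{K\text{ compact},\ K\subset G}cap_p(K,\Omega).$$ For $i\ge1$ let $\omega_i(x_0)=\{x:2^{-i-1}\le|x-x_0|\le2^{-i}\}$ and $\Omega_i(x_0)=\{x:2^{-i-2}\le|x-x_0|\le2^{-i+1}\}$. A set $E\subset\mathbb R^n$ is called $p$-thin at $x_0$, for $1<p<n$, if $$\sum_{i=1}^\infty\frac{cap_p(E\cap\omega_i(x_0),\Omega_i(x_0))}{cap_p(\partial B(x_0,2^{-i}),B(x_0,2^{-i+1}))}<+\infty,$$ and $n$-thin at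 $x_0$, for $p=n$, if $$\sum_{i=1}^\infty i^{n-1}\,cap_n(E\cap\omega_i(x_0),\Omega_i(x_0))<+\infty.$$ **Theorem.** Let $E\subset\mathbb R^n$ be an arbitrary set that is $p$-thin at $x_0$, where $p\in(1,n]$. Then there is a ray from $x_0$ that avoids $E$ within some small ball at $x_0$, the point $x_0$ itself excepted: there are a unit vector $v\in\mathbb R^n$ and $r>0$ such that $$\{x_0+tv:\ t>0\}\cap B(x_0,r)\cap E=\emptyset.$$ -/

import Mathlib

open scoped ENNReal ContDiff

noncomputable section

/-- The `p`-energy `∫_Ω |∇u|^p dx`, as an extended nonnegative real. The operator norm of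
`fderiv ℝ u x` for the Euclidean norm is the Euclidean norm of the gradient of `u` at `x`. -/
def pEnergy {n : ℕ} (p : ℝ) (Ω : Set (EuclideanSpace ℝ (Fin n)))
    (u : EuclideanSpace ℝ (Fin n) → ℝ) : ℝ≥0∞ :=
  ∫⁻ x in Ω, ‖fderiv ℝ u x‖ₑ ^ p

/-- `u ∈ C₀^∞(Ω)`: smooth, with compact support contained in `Ω` (extended by zero to `ℝⁿ`). -/
def IsTestFunction {n : ℕ} (Ω : Set (EuclideanSpace ℝ (Fin n)))
    (u : EuclideanSpace ℝ (Fin n) → ℝ) : Prop :=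
  ContDiff ℝ ∞ u ∧ HasCompactSupport u ∧ tsupport u ⊆ Ω

/-- `cap_p(K, Ω)` for compact `K`: the infimum of the `p`-energies of the `u ∈ C₀^∞(Ω)` with
`u ≥ 1` on `K`. -/
def pCapCompact {n : ℕ} (p : ℝ) (K Ω : Set (EuclideanSpace ℝ (Fin n))) : ℝ≥0∞ :=
  ⨅ (u : EuclideanSpace ℝ (Fin n) → ℝ) (_ : IsTestFunction Ω u) (_ : ∀ x ∈ K, 1 ≤ u x),
    pEnergy p Ω u

/-- `cap_p(E, Ω)` for arbitrary `E ⊆ Ω`: the infimum over the open `G` with `E ⊆ G ⊆ Ω` of the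
supremum over the compact `K ⊆ G` of `cap_p(K, Ω)`. -/
def pCap {n : ℕ} (p : ℝ) (E Ω : Set (EuclideanSpace ℝ (Fin n))) : ℝ≥0∞ :=
  ⨅ (G : Set (EuclideanSpace ℝ (Fin n))) (_ : IsOpen G) (_ : E ⊆ G) (_ : G ⊆ Ω),
    ⨆ (K : Set (EuclideanSpace ℝ (Fin n))) (_ : IsCompact K) (_ : K ⊆ G), pCapCompact p K Ω

/-- The dyadic annulus `ω_i(x₀) = {x : 2^{-i-1} ≤ |x - x₀| ≤ 2^{-i}}`. -/
def innerAnnulus {n : ℕ} (x₀ : EuclideanSpace ℝ (Fin n)) (i : ℕ) :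
    Set (EuclideanSpace ℝ (Fin n)) :=
  {x | (2 : ℝ) ^ (-(i : ℤ) - 1) ≤ ‖x - x₀‖ ∧ ‖x - x₀‖ ≤ (2 : ℝ) ^ (-(i : ℤ))}

/-- The larger annulus `Ω_i(x₀) = {x : 2^{-i-2} ≤ |x - x₀| ≤ 2^{-i+1}}`. -/
def outerAnnulus {n : ℕ} (x₀ : EuclideanSpace ℝ (Fin n)) (i : ℕ) :
    Set (EuclideanSpace ℝ (Fin n)) :=
  {x | (2 : ℝ) ^ (-(i : ℤ) - 2) ≤ ‖x - x₀‖ ∧ ‖x - x₀‖ ≤ (2 : ℝ) ^ (-(i : ℤ) + 1)}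

/-- `E ⊆ ℝⁿ` is `p`-thin at `x₀`, for `p ∈ (1, n]`. For `p < n` this is
`∑_{i ≥ 1} cap_p(E ∩ ω_i, Ω_i) / cap_p(∂B(x₀, 2^{-i}), B(x₀, 2^{-i+1})) < ∞`, and for `p = n` it
is `∑_{i ≥ 1} i^{n-1} cap_n(E ∩ ω_i, Ω_i) < ∞`. The index `j` below is `i - 1`. -/
def IsPThin {n : ℕ} (p : ℝ) (E : Set (EuclideanSpace ℝ (Fin n)))
    (x₀ : EuclideanSpace ℝ (Fin n)) : Prop :=
  (1 < p ∧ p < n ∧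
    ∑' j : ℕ, pCap p (E ∩ innerAnnulus x₀ (j + 1)) (outerAnnulus x₀ (j + 1)) /
      pCap p (Metric.sphere x₀ ((2 : ℝ) ^ (-((j + 1 : ℕ) : ℤ))))
        (Metric.ball x₀ ((2 : ℝ) ^ (-((j + 1 : ℕ) : ℤ) + 1))) < ⊤) ∨
  (1 < p ∧ p = n ∧
    ∑' j : ℕ, ((j + 1 : ℕ) : ℝ≥0∞) ^ (n - 1) *
      pCap p (E ∩ innerAnnulus x₀ (j + 1)) (outerAnnulus x₀ (j + 1)) < ⊤)

/-- The ray from `x₀` in the direction `v`, without its starting point. -/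
def openRay {n : ℕ} (x₀ v : EuclideanSpace ℝ (Fin n)) : Set (EuclideanSpace ℝ (Fin n)) :=
  {x | ∃ t : ℝ, 0 < t ∧ x = x₀ + t • v}

end

open MeasureTheory Set Metric Filter Topology

open scoped ENNReal

/-! Project each dyadic piece of `E` radially onto the unit sphere. If `u` is a test function for a
piece at scale `ρ`, then on every ray meeting the piece `u` falls from at least 1 to 0, so `|∇u|`
has integral at least 1 there. Hölder's inequality and polar coordinates, where `t ^ (n - 1)` is
comparable to `ρ ^ (n - 1)`, bound the measure of the projection by a constant times `ρ ^ (p - n)`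
times the capacity (`toSphere_directionSet_le_pCap`). For `p < n` the factor `ρ ^ (p - n)` is
absorbed by the capacity of the sphere (`exists_pCap_sphere_le`); for `p = n` it is 1. Thinness thus
makes the projections summable, and the tail of the series cannot cover the sphere: any direction
left uncovered works. -/

/-! ### Polar coordinates and estimates on a single ray -/

/-- Integration in polar coordinates for extended nonnegative functions. -/
theorem lintegral_eq_lintegral_toSphere_lintegral_Ioi {F : Type*} [NormedAddCommGroup F]
    [NormedSpace ℝ F] [FiniteDimensional ℝ F] [Nontrivial F] [MeasurableSpace F] [BorelSpace F]
    (μ : Measure F) [μ.IsAddHaarMeasure] {f : F → ℝ≥0∞} (hf : Measurable f) :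
    ∫⁻ x, f x ∂μ = ∫⁻ v : sphere (0 : F) 1, (∫⁻ t in Ioi (0 : ℝ),
      ENNReal.ofReal (t ^ (Module.finrank ℝ F - 1)) * f (t • (v : F))) ∂μ.toSphere := by
  have hfm : Measurable fun q : sphere (0 : F) 1 × Ioi (0 : ℝ) ↦ f ((q.2 : ℝ) • (q.1 : F)) :=
    hf.comp (Continuous.measurable (by fun_prop))
  have hmp := μ.measurePreserving_homeomorphUnitSphereProd
  calc
    ∫⁻ x, f x ∂μ = ∫⁻ x : ({0}ᶜ : Set F), f x ∂(μ.comap (↑)) := by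
      rw [lintegral_subtype_comap (measurableSet_singleton _).compl, restrict_compl_singleton]
    _ = ∫⁻ q, f ((q.2 : ℝ) • (q.1 : F))
          ∂(μ.toSphere.prod (Measure.volumeIoiPow (Module.finrank ℝ F - 1))) := by
      rw [← hmp.lintegral_comp hfm]
      refine lintegral_congr fun x ↦ ?_
      have hx : ‖(x : F)‖ ≠ 0 := norm_ne_zero_iff.2 x.2
      simp [smul_smul, hx]
    _ = _ := by
      rw [lintegral_prod _ hfm.aemeasurable]
      refine lintegral_congr fun v ↦ ?_
      have hm : Measurable fun t : Ioi (0 : ℝ) ↦ f ((t : ℝ) • (v : F)) :=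
        hf.comp (Continuous.measurable (by fun_prop))
      rw [Measure.volumeIoiPow, lintegral_withDensity_eq_lintegral_mul _ (by fun_prop) hm]
      simp only [Pi.mul_apply]
      exact lintegral_subtype_comap measurableSet_Ioi
        (fun t ↦ ENNReal.ofReal (t ^ (Module.finrank ℝ F - 1)) * f (t • (v : F)))

/-- Jensen's inequality on an interval, for extended nonnegative functions. -/
theorem rpow_lintegral_Ioc_le {p a b : ℝ} (hp : 1 < p) {f : ℝ → ℝ≥0∞} (hf : Measurable f) :
    (∫⁻ t in Ioc a b, f t) ^ p ≤
      (∫⁻ t in Ioc a b, f t ^ p) * ENNReal.ofReal (b - a) ^ (p - 1) := by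
  have hpq := Real.HolderConjugate.conjExponent hp
  have h := ENNReal.lintegral_mul_le_Lp_mul_Lq (volume.restrict (Ioc a b)) hpq
    hf.aemeasurable (aemeasurable_const (b := (1 : ℝ≥0∞)))
  have hp0 : 0 < p := by linarith
  simp only [Pi.mul_apply, mul_one, ENNReal.one_rpow, lintegral_one, Measure.restrict_apply_univ,
    Real.volume_Ioc] at h
  refine (ENNReal.rpow_le_rpow h hp0.le).trans_eq ?_
  rw [ENNReal.mul_rpow_of_nonneg _ _ hp0.le, ← ENNReal.rpow_mul, ← ENNReal.rpow_mul,
    one_div_mul_cancel hp0.ne', ENNReal.rpow_one]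
  congr 2
  have : p - 1 ≠ 0 := by linarith
  simp only [Real.conjExponent]
  field_simp

/-- If a `C¹` function is at least `1` at one point of a ray and vanishes further out, then its
gradient has total mass at least `1` along the segment between. -/
theorem one_le_lintegral_enorm_fderiv_of_ray {F : Type*} [NormedAddCommGroup F] [NormedSpace ℝ F]
    {u : F → ℝ} (hu : ContDiff ℝ 1 u) {x₀ v : F} (hv : ‖v‖ = 1) {a s b : ℝ} (has : a ≤ s)
    (hsb : s ≤ b) (hs : 1 ≤ u (x₀ + s • v)) (hb : u (x₀ + b • v) = 0) :
    1 ≤ ∫⁻ t in Ioc a b, ‖fderiv ℝ u (x₀ + t • v)‖ₑ := by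
  have hd : ∀ t : ℝ, HasDerivAt (fun t : ℝ ↦ u (x₀ + t • v)) (fderiv ℝ u (x₀ + t • v) v) t := by
    intro t
    have h1 : HasDerivAt (fun t : ℝ ↦ x₀ + t • v) v t := by
      simpa using ((hasDerivAt_id t).smul_const v).const_add x₀
    exact ((hu.differentiable one_ne_zero).differentiableAt.hasFDerivAt).comp_hasDerivAt t h1
  have hc : Continuous fun t : ℝ ↦ fderiv ℝ u (x₀ + t • v) v :=
    ((hu.continuous_fderiv one_ne_zero).comp (by fun_prop)).clm_apply continuous_const
  have hint := intervalIntegral.integral_eq_sub_of_hasDerivAt (fun t _ ↦ hd t)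
    (hc.intervalIntegrable s b)
  rw [hb, zero_sub, intervalIntegral.integral_of_le hsb] at hint
  have h1 : (1 : ℝ≥0∞) ≤ ‖∫ t in Ioc s b, fderiv ℝ u (x₀ + t • v) v‖ₑ := by
    rw [hint, enorm_neg, Real.enorm_eq_ofReal (zero_le_one.trans hs)]
    simpa using ENNReal.ofReal_le_ofReal hs
  refine h1.trans ((enorm_integral_le_lintegral_enorm _).trans ?_)
  refine (lintegral_mono fun t ↦ ?_).trans (lintegral_mono_set (Ioc_subset_Ioc_left has))
  rw [← ofReal_norm, ← ofReal_norm]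
  refine ENNReal.ofReal_le_ofReal ?_
  simpa [hv] using (fderiv ℝ u (x₀ + t • v)).le_opNorm v

/-! ### Measure of directions against capacity -/

/-- The set of directions of the rays from `x₀` that meet `E`. -/
def directionSet {n : ℕ} (x₀ : EuclideanSpace ℝ (Fin n)) (E : Set (EuclideanSpace ℝ (Fin n))) :
    Set (sphere (0 : EuclideanSpace ℝ (Fin n)) 1) :=
  {v | ∃ t : ℝ, 0 < t ∧ x₀ + t • (v : EuclideanSpace ℝ (Fin n)) ∈ E}

theorem directionSet_mono {n : ℕ} (x₀ : EuclideanSpace ℝ (Fin n))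
    {E E' : Set (EuclideanSpace ℝ (Fin n))} (h : E ⊆ E') :
    directionSet x₀ E ⊆ directionSet x₀ E' :=
  fun _ ⟨t, ht, htE⟩ ↦ ⟨t, ht, h htE⟩

theorem directionSet_iUnion {n : ℕ} {ι : Sort*} (x₀ : EuclideanSpace ℝ (Fin n))
    (E : ι → Set (EuclideanSpace ℝ (Fin n))) :
    directionSet x₀ (⋃ i, E i) = ⋃ i, directionSet x₀ (E i) := by
  ext v
  simp only [directionSet, mem_iUnion, mem_ofPred_eq]
  exact ⟨fun ⟨t, ht, i, hi⟩ ↦ ⟨i, t, ht, hi⟩, fun ⟨i, t, ht, hi⟩ ↦ ⟨t, ht, i, hi⟩⟩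

theorem pEnergy_eq_lintegral {n : ℕ} {p : ℝ} (hp : 0 < p) {Ω : Set (EuclideanSpace ℝ (Fin n))}
    (hΩ : MeasurableSet Ω) {u : EuclideanSpace ℝ (Fin n) → ℝ} (hu : tsupport u ⊆ Ω) :
    pEnergy p Ω u = ∫⁻ x, ‖fderiv ℝ u x‖ₑ ^ p := by
  rw [pEnergy, ← lintegral_indicator hΩ, indicator_eq_self.2]
  intro x hx
  refine hu (support_fderiv_subset ℝ (f := u) fun h ↦ hx ?_)
  have h0 : ‖fderiv ℝ u x‖ₑ = 0 := by rw [← ofReal_norm, h, norm_zero, ENNReal.ofReal_zero]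
  simp only [h0, ENNReal.zero_rpow_of_pos hp]

/-- The constant comparing the measure of a set of directions with the capacity at scale `ρ`. -/
noncomputable def directionConst (n : ℕ) (p ρ : ℝ) : ℝ :=
  (4 * ρ) ^ (p - 1) * ((ρ / 4) ^ (n - 1))⁻¹

/-- On `[ρ/4, 4ρ]` Jensen costs the factor `(4ρ) ^ (p - 1)`, and inserting the polar weight costs
`(ρ/4) ^ (1 - n)`. -/
theorem one_le_directionConst_mul {n : ℕ} {p ρ : ℝ} (hp : 1 < p) (hρ : 0 < ρ)
    {u : EuclideanSpace ℝ (Fin n) → ℝ} (hu : ContDiff ℝ 1 u) {x₀ v : EuclideanSpace ℝ (Fin n)}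
    (hv : ‖v‖ = 1) {s : ℝ} (has : ρ / 4 ≤ s) (hsb : s ≤ 4 * ρ) (hs : 1 ≤ u (x₀ + s • v))
    (hb : u (x₀ + (4 * ρ) • v) = 0) :
    1 ≤ ENNReal.ofReal (directionConst n p ρ) * ∫⁻ t in Ioi (0 : ℝ),
      ENNReal.ofReal (t ^ (n - 1)) * ‖fderiv ℝ u (x₀ + t • v)‖ₑ ^ p := by
  have hm : Measurable fun t : ℝ ↦ ‖fderiv ℝ u (x₀ + t • v)‖ₑ :=
    ((hu.continuous_fderiv one_ne_zero).comp (by fun_prop)).enorm.measurable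
  have hp0 : 0 < p := by linarith
  have h1 := ENNReal.rpow_le_rpow
    (one_le_lintegral_enorm_fderiv_of_ray hu hv has hsb hs hb) hp0.le
  rw [ENNReal.one_rpow] at h1
  have h2 := h1.trans (rpow_lintegral_Ioc_le hp hm)
  have hpow : 0 < (ρ / 4) ^ (n - 1) := by positivity
  have h3 : ∫⁻ t in Ioc (ρ / 4) (4 * ρ), ‖fderiv ℝ u (x₀ + t • v)‖ₑ ^ p ≤
      ENNReal.ofReal ((ρ / 4) ^ (n - 1))⁻¹ * ∫⁻ t in Ioi (0 : ℝ),
        ENNReal.ofReal (t ^ (n - 1)) * ‖fderiv ℝ u (x₀ + t • v)‖ₑ ^ p := by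
    rw [← lintegral_const_mul' _ _ ENNReal.ofReal_ne_top]
    have hsub : Ioc (ρ / 4) (4 * ρ) ⊆ Ioi 0 := fun t ht ↦ lt_trans (by positivity) ht.1
    refine le_trans (setLIntegral_mono' measurableSet_Ioc fun t ht ↦ ?_) (lintegral_mono_set hsub)
    rw [← mul_assoc, ← ENNReal.ofReal_mul (by positivity)]
    refine le_mul_of_one_le_left zero_le ?_
    rw [ENNReal.one_le_ofReal, ← div_eq_inv_mul, one_le_div hpow]
    exact pow_le_pow_left₀ (by positivity) ht.1.le _
  have h4 : ENNReal.ofReal (4 * ρ - ρ / 4) ^ (p - 1) ≤ ENNReal.ofReal ((4 * ρ) ^ (p - 1)) := by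
    rw [ENNReal.ofReal_rpow_of_nonneg (by linarith) (by linarith)]
    exact ENNReal.ofReal_le_ofReal
      (Real.rpow_le_rpow (by linarith) (by linarith) (by linarith))
  refine h2.trans ((mul_le_mul' h3 h4).trans_eq ?_)
  rw [directionConst, ENNReal.ofReal_mul (by positivity)]
  ring

theorem toSphere_directionSet_le_pEnergy {n : ℕ} (hn : n ≠ 0) {p ρ : ℝ} (hp : 1 < p) (hρ : 0 < ρ)
    {x₀ : EuclideanSpace ℝ (Fin n)} {K Ω : Set (EuclideanSpace ℝ (Fin n))}
    (hΩm : MeasurableSet Ω) (hΩ : ∀ x ∈ Ω, ρ / 4 ≤ ‖x - x₀‖ ∧ ‖x - x₀‖ ≤ 2 * ρ) (hK : K ⊆ Ω)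
    {u : EuclideanSpace ℝ (Fin n) → ℝ} (hu : IsTestFunction Ω u) (huK : ∀ x ∈ K, 1 ≤ u x) :
    (volume : Measure (EuclideanSpace ℝ (Fin n))).toSphere (directionSet x₀ K) ≤
      ENNReal.ofReal (directionConst n p ρ) * pEnergy p Ω u := by
  have : Nonempty (Fin n) := ⟨⟨0, Nat.pos_of_ne_zero hn⟩⟩
  obtain ⟨hu1, -, hu3⟩ := hu
  have hu1' : ContDiff ℝ 1 u := hu1.of_le (by exact_mod_cast le_top)
  have hp0 : 0 < p := by linarith
  have hcf : Continuous (fderiv ℝ u) := hu1'.continuous_fderiv one_ne_zero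
  have hfm : Measurable fun x ↦ ‖fderiv ℝ u (x₀ + x)‖ₑ ^ p :=
    ((hcf.comp (by fun_prop)).enorm.measurable).pow_const p
  set g : sphere (0 : EuclideanSpace ℝ (Fin n)) 1 → ℝ≥0∞ := fun v ↦ ∫⁻ t in Ioi (0 : ℝ),
    ENNReal.ofReal (t ^ (n - 1)) * ‖fderiv ℝ u (x₀ + t • (v : EuclideanSpace ℝ (Fin n)))‖ₑ ^ p
    with hg
  have hE : pEnergy p Ω u = ∫⁻ v, g v ∂(volume : Measure (EuclideanSpace ℝ (Fin n))).toSphere := by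
    rw [pEnergy_eq_lintegral hp0 hΩm hu3,
      ← lintegral_add_left_eq_self (μ := volume) (fun x ↦ ‖fderiv ℝ u x‖ₑ ^ p) x₀,
      lintegral_eq_lintegral_toSphere_lintegral_Ioi volume hfm]
    simp [hg]
  have hgm : Measurable g := by
    refine Measurable.lintegral_prod_right' (ν := volume.restrict (Ioi (0 : ℝ)))
      (f := fun q : sphere (0 : EuclideanSpace ℝ (Fin n)) 1 × ℝ ↦ ENNReal.ofReal (q.2 ^ (n - 1)) *
      ‖fderiv ℝ u (x₀ + q.2 • (q.1 : EuclideanSpace ℝ (Fin n)))‖ₑ ^ p) ?_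
    refine Measurable.mul (by fun_prop) ?_
    exact ((hcf.comp (by fun_prop)).enorm.measurable).pow_const p
  rw [hE, ← lintegral_const_mul _ hgm]
  -- Markov's inequality at level 1 is applied to the measurable majorant, so the direction set need
  -- not be measurable.
  refine le_trans (measure_mono fun v hv ↦ ?_)
    (by simpa using mul_meas_ge_le_lintegral (hgm.const_mul _) 1)
  obtain ⟨s, hs0, hsK⟩ := hv
  have hv1 : ‖(v : EuclideanSpace ℝ (Fin n))‖ = 1 := by simp
  have hsΩ := hΩ _ (hK hsK)
  have hnorm : ‖x₀ + s • (v : EuclideanSpace ℝ (Fin n)) - x₀‖ = s := by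
    rw [add_sub_cancel_left, norm_smul, hv1, mul_one, Real.norm_of_nonneg hs0.le]
  rw [hnorm] at hsΩ
  -- The endpoint `4ρ` lies strictly beyond the radius `2ρ` that bounds `Ω`, so `u` vanishes there.
  refine one_le_directionConst_mul hp hρ hu1' hv1 hsΩ.1 (by linarith) (huK _ hsK) ?_
  refine image_eq_zero_of_notMem_tsupport fun h ↦ ?_
  have := (hΩ _ (hu3 h)).2
  rw [add_sub_cancel_left, norm_smul, hv1, mul_one, Real.norm_of_nonneg (by positivity)] at this
  linarith

theorem toSphere_directionSet_le_pCap {n : ℕ} (hn : n ≠ 0) {p ρ : ℝ} (hp : 1 < p) (hρ : 0 < ρ)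
    {x₀ : EuclideanSpace ℝ (Fin n)} {E Ω : Set (EuclideanSpace ℝ (Fin n))}
    (hΩm : MeasurableSet Ω) (hΩ : ∀ x ∈ Ω, ρ / 4 ≤ ‖x - x₀‖ ∧ ‖x - x₀‖ ≤ 2 * ρ) :
    (volume : Measure (EuclideanSpace ℝ (Fin n))).toSphere (directionSet x₀ E) ≤
      ENNReal.ofReal (directionConst n p ρ) * pCap p E Ω := by
  have hC0 : ENNReal.ofReal (directionConst n p ρ) ≠ 0 := by
    rw [directionConst]
    simp only [ne_eq, ENNReal.ofReal_eq_zero, not_le]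
    positivity
  -- Dividing by the constant leaves the capacity alone on the right, where its infima and suprema
  -- can be unfolded.
  have hmove : ∀ a b : ℝ≥0∞, a ≤ ENNReal.ofReal (directionConst n p ρ) * b ↔
      a / ENNReal.ofReal (directionConst n p ρ) ≤ b := fun a b ↦ by
    rw [mul_comm, ENNReal.div_le_iff hC0 ENNReal.ofReal_ne_top]
  rw [hmove, pCap]
  refine le_iInf fun G ↦ le_iInf fun hG ↦ le_iInf fun hEG ↦ le_iInf fun hGΩ ↦ ?_
  rw [← hmove]
  -- Exhaust `G` by an increasing sequence of closed sets, compact because `Ω` is bounded;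
  -- continuity of the measure along increasing unions passes to the limit.
  obtain ⟨K, hKc, hKG, hKU, hKm⟩ := hG.exists_iUnion_isClosed
  have hsub : directionSet x₀ E ⊆ ⋃ m, directionSet x₀ (K m) := by
    rw [← directionSet_iUnion, hKU]
    exact directionSet_mono x₀ hEG
  refine (measure_mono hsub).trans ?_
  rw [Monotone.measure_iUnion fun i j hij ↦ directionSet_mono x₀ (hKm hij)]
  refine iSup_le fun m ↦ ?_
  rw [hmove]
  have hKmc : IsCompact (K m) := by
    refine (isCompact_closedBall x₀ (2 * ρ)).of_isClosed_subset (hKc m) fun x hx ↦ ?_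
    rw [mem_closedBall, dist_eq_norm]
    exact (hΩ x (hGΩ (hKG m hx))).2
  refine le_iSup_of_le (K m) (le_iSup_of_le hKmc (le_iSup_of_le (hKG m) ?_))
  refine le_iInf fun u ↦ le_iInf fun hu ↦ le_iInf fun huK ↦ ?_
  rw [← hmove]
  exact toSphere_directionSet_le_pEnergy hn hp hρ hΩm hΩ ((hKG m).trans hGΩ) hu huK

/-! ### Upper bound for the capacity of a sphere -/

theorem pCap_le_pEnergy {n : ℕ} {p : ℝ} {G Ω E : Set (EuclideanSpace ℝ (Fin n))} (hG : IsOpen G)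
    (hEG : E ⊆ G) (hGΩ : G ⊆ Ω) {u : EuclideanSpace ℝ (Fin n) → ℝ} (hu : IsTestFunction Ω u)
    (huG : ∀ x ∈ G, 1 ≤ u x) : pCap p E Ω ≤ pEnergy p Ω u := by
  refine iInf_le_of_le G (iInf_le_of_le hG (iInf_le_of_le hEG (iInf_le_of_le hGΩ ?_)))
  refine iSup_le fun K ↦ iSup_le fun _ ↦ iSup_le fun hKG ↦ ?_
  exact iInf_le_of_le u (iInf_le_of_le hu (iInf_le_of_le (fun x hx ↦ huG x (hKG hx)) le_rfl))

/-- The capacity of a sphere of radius `ρ` in the concentric ball of radius `2ρ` is at most a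
constant multiple of `ρ ^ (n - p)`. -/
theorem exists_pCap_sphere_le (n : ℕ) {p : ℝ} (hp : 0 < p) :
    ∃ M : ℝ, 0 < M ∧ ∀ (x₀ : EuclideanSpace ℝ (Fin n)) (ρ : ℝ), 0 < ρ →
      pCap p (sphere x₀ ρ) (ball x₀ (2 * ρ)) ≤ ENNReal.ofReal (M * ρ ^ ((n : ℝ) - p)) := by
  -- With radii `1 < 5/4 < 3/2 < 2` the rescaled bump is 1 on an open neighbourhood of the sphere,
  -- as `pCap` requires, and is supported inside the ball.
  let φ : ContDiffBump (0 : EuclideanSpace ℝ (Fin n)) := ⟨5 / 4, 3 / 2, by norm_num, by norm_num⟩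
  have hφ : ContDiff ℝ 1 φ := φ.contDiff
  obtain ⟨D, hD⟩ := (φ.hasCompactSupport.fderiv (𝕜 := ℝ)).exists_bound_of_continuous
    (hφ.continuous_fderiv one_ne_zero)
  set D' := max D 1
  have hD1 : 0 < D' := lt_max_of_lt_right one_pos
  have hD' : ∀ x, ‖fderiv ℝ φ x‖ ≤ D' := fun x ↦ (hD x).trans (le_max_left _ _)
  set V := (volume : Measure (EuclideanSpace ℝ (Fin n))).real (ball 0 1)
  have hV : 0 < V := ENNReal.toReal_pos (measure_ball_pos _ _ one_pos).ne' measure_ball_lt_top.ne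
  refine ⟨D' ^ p * 2 ^ n * V, by positivity, fun x₀ ρ hρ ↦ ?_⟩
  set u : EuclideanSpace ℝ (Fin n) → ℝ := fun x ↦ φ (ρ⁻¹ • (x - x₀)) with hu
  have hnorm : ∀ x, ‖ρ⁻¹ • (x - x₀)‖ = ‖x - x₀‖ / ρ := fun x ↦ by
    rw [norm_smul, norm_inv, Real.norm_of_nonneg hρ.le, inv_mul_eq_div]
  have hts : tsupport u ⊆ closedBall x₀ (3 / 2 * ρ) := by
    refine closure_minimal (fun x hx ↦ ?_) isClosed_closedBall
    have hx' : ρ⁻¹ • (x - x₀) ∈ Function.support φ := hx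
    rw [φ.support_eq, mem_ball_zero_iff, hnorm, div_lt_iff₀ hρ] at hx'
    rw [mem_closedBall, dist_eq_norm]
    exact hx'.le
  have hball : closedBall x₀ (3 / 2 * ρ) ⊆ ball x₀ (2 * ρ) :=
    closedBall_subset_ball (by linarith)
  have htest : IsTestFunction (ball x₀ (2 * ρ)) u := by
    refine ⟨φ.contDiff.comp (by fun_prop), ?_, hts.trans hball⟩
    exact (isCompact_closedBall _ _).of_isClosed_subset (isClosed_tsupport u) hts
  have hone : ∀ x ∈ ball x₀ (5 / 4 * ρ), 1 ≤ u x := by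
    intro x hx
    rw [mem_ball, dist_eq_norm] at hx
    refine (φ.one_of_mem_closedBall ?_).ge
    rw [mem_closedBall_zero_iff, hnorm, div_le_iff₀ hρ]
    exact hx.le
  refine (pCap_le_pEnergy isOpen_ball (sphere_subset_ball (by linarith))
    (ball_subset_ball (by linarith)) htest hone).trans ?_
  have hgrad : ∀ x, ‖fderiv ℝ u x‖ₑ ^ p ≤ ENNReal.ofReal ((D' / ρ) ^ p) := by
    intro x
    have h1 : HasFDerivAt (fun x ↦ ρ⁻¹ • (x - x₀))
        (ρ⁻¹ • ContinuousLinearMap.id ℝ (EuclideanSpace ℝ (Fin n))) x :=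
      ((hasFDerivAt_id x).sub_const x₀).const_smul ρ⁻¹
    have h2 : fderiv ℝ u x = ρ⁻¹ • fderiv ℝ φ (ρ⁻¹ • (x - x₀)) := by
      have h3 := ((hφ.differentiable one_ne_zero).differentiableAt
        (x := ρ⁻¹ • (x - x₀))).hasFDerivAt.comp x h1
      refine h3.fderiv.trans ?_
      ext y
      simp
    have h4 : ‖fderiv ℝ u x‖ ≤ D' / ρ := by
      rw [h2, norm_smul, norm_inv, Real.norm_of_nonneg hρ.le, inv_mul_eq_div]
      gcongr
      exact hD' _
    rw [← ofReal_norm, ENNReal.ofReal_rpow_of_nonneg (norm_nonneg _) hp.le]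
    exact ENNReal.ofReal_le_ofReal (Real.rpow_le_rpow (norm_nonneg _) h4 hp.le)
  calc
    pEnergy p (ball x₀ (2 * ρ)) u
      ≤ ∫⁻ _ in ball x₀ (2 * ρ), ENNReal.ofReal ((D' / ρ) ^ p) := lintegral_mono hgrad
    _ = ENNReal.ofReal ((D' / ρ) ^ p) * (ENNReal.ofReal ((2 * ρ) ^ n) * ENNReal.ofReal V) := by
      rw [setLIntegral_const, Measure.addHaar_ball_of_pos _ _ (by positivity), finrank_euclideanSpace_fin,
        ofReal_measureReal]
    _ = ENNReal.ofReal (D' ^ p * 2 ^ n * V * ρ ^ ((n : ℝ) - p)) := by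
      rw [← ENNReal.ofReal_mul (by positivity), ← ENNReal.ofReal_mul (by positivity),
        Real.div_rpow hD1.le hρ.le, Real.rpow_sub hρ, Real.rpow_natCast, mul_pow]
      congr 1
      ring

/-! ### Summation over the dyadic annuli -/

theorem directionConst_eq {n : ℕ} (hn : n ≠ 0) {p ρ : ℝ} (hρ : 0 < ρ) :
    directionConst n p ρ = 4 ^ (p - 1) * 4 ^ (n - 1) * (ρ ^ ((n : ℝ) - p))⁻¹ := by
  rw [directionConst, Real.mul_rpow (by norm_num) hρ.le, div_pow, inv_div,
    ← Real.rpow_neg hρ.le, neg_sub]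
  have h : ρ ^ (p - n) = ρ ^ (p - 1) / ρ ^ (n - 1) := by
    rw [← Real.rpow_natCast ρ (n - 1), ← Real.rpow_sub hρ, Nat.cast_pred (Nat.pos_of_ne_zero hn)]
    congr 1
    ring
  rw [h]
  ring

theorem mem_innerAnnulus_of_norm {n : ℕ} {x₀ x : EuclideanSpace ℝ (Fin n)} {m : ℕ}
    (hx0 : 0 < ‖x - x₀‖) (hx : ‖x - x₀‖ < (2 : ℝ) ^ (-(m : ℤ))) :
    ∃ k : ℕ, x ∈ innerAnnulus x₀ (k + m) := by
  obtain ⟨k, hk1, hk2⟩ := exists_mem_Ioc_zpow hx0 (one_lt_two (α := ℝ))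
  have hkm : k < -(m : ℤ) := (zpow_lt_zpow_iff_right₀ one_lt_two).1 (hk1.trans hx)
  refine ⟨(-k - 1 - m).toNat, ?_⟩
  have hc : -(((-k - 1 - m).toNat + m : ℕ) : ℤ) = k + 1 := by omega
  rw [innerAnnulus, mem_ofPred_eq, hc, add_sub_cancel_right]
  exact ⟨hk1.le, hk2⟩

theorem measurableSet_outerAnnulus {n : ℕ} (x₀ : EuclideanSpace ℝ (Fin n)) (i : ℕ) :
    MeasurableSet (outerAnnulus x₀ i) := by
  have hc : Continuous fun x : EuclideanSpace ℝ (Fin n) ↦ ‖x - x₀‖ := by fun_prop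
  exact ((isClosed_le continuous_const hc).inter (isClosed_le hc continuous_const)).measurableSet

theorem toSphere_directionSet_innerAnnulus_le {n : ℕ} (hn : n ≠ 0) {p : ℝ} (hp : 1 < p)
    (E : Set (EuclideanSpace ℝ (Fin n))) (x₀ : EuclideanSpace ℝ (Fin n)) (i : ℕ) :
    (volume : Measure (EuclideanSpace ℝ (Fin n))).toSphere
        (directionSet x₀ (E ∩ innerAnnulus x₀ i)) ≤
      ENNReal.ofReal (directionConst n p ((2 : ℝ) ^ (-(i : ℤ)))) *
        pCap p (E ∩ innerAnnulus x₀ i) (outerAnnulus x₀ i) := by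
  refine toSphere_directionSet_le_pCap hn hp (by positivity) (measurableSet_outerAnnulus x₀ i)
    fun x hx ↦ ?_
  obtain ⟨h1, h2⟩ := hx
  rw [zpow_sub₀ two_ne_zero] at h1
  rw [zpow_add₀ two_ne_zero] at h2
  norm_num at h1 h2
  constructor <;> norm_num <;> linarith

/-- The directions met by a `p`-thin set in the dyadic annuli have summable measures. -/
theorem IsPThin.tsum_toSphere_directionSet_ne_top {n : ℕ} {p : ℝ}
    {E : Set (EuclideanSpace ℝ (Fin n))} {x₀ : EuclideanSpace ℝ (Fin n)} (hn : n ≠ 0)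
    (hE : IsPThin p E x₀) :
    ∑' j : ℕ, (volume : Measure (EuclideanSpace ℝ (Fin n))).toSphere
      (directionSet x₀ (E ∩ innerAnnulus x₀ (j + 1))) ≠ ⊤ := by
  rcases hE with ⟨hp, -, hsum⟩ | ⟨hp, rfl, hsum⟩
  · obtain ⟨M, hM, hcap⟩ := exists_pCap_sphere_le n (p := p) (by linarith)
    set C : ℝ := 4 ^ (p - 1) * 4 ^ (n - 1) * M
    refine ne_top_of_le_ne_top (ENNReal.mul_ne_top (ENNReal.ofReal_ne_top (r := C)) hsum.ne) ?_
    rw [← ENNReal.tsum_mul_left]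
    refine ENNReal.tsum_le_tsum fun j ↦ ?_
    refine (toSphere_directionSet_innerAnnulus_le hn hp E x₀ (j + 1)).trans ?_
    set ρ : ℝ := (2 : ℝ) ^ (-((j + 1 : ℕ) : ℤ))
    have hρ : 0 < ρ := by positivity
    have h2ρ : (2 : ℝ) ^ (-((j + 1 : ℕ) : ℤ) + 1) = 2 * ρ := by
      rw [zpow_add₀ two_ne_zero, zpow_one, mul_comm]
    have hb : 0 < M * ρ ^ ((n : ℝ) - p) := by positivity
    rw [h2ρ]
    have hC : directionConst n p ρ = C * (M * ρ ^ ((n : ℝ) - p))⁻¹ := by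
      rw [directionConst_eq hn hρ, mul_inv]
      field_simp
      simp only [C]
    rw [hC, ENNReal.ofReal_mul (by positivity), mul_assoc, ENNReal.ofReal_inv_of_pos hb,
      mul_comm _⁻¹, ← div_eq_mul_inv]
    gcongr
    -- The sphere capacity is a denominator, so only its upper bound matters.
    exact hcap x₀ ρ hρ
  · set C : ℝ := 4 ^ ((n : ℝ) - 1) * 4 ^ (n - 1)
    refine ne_top_of_le_ne_top (ENNReal.mul_ne_top (ENNReal.ofReal_ne_top (r := C)) hsum.ne) ?_
    rw [← ENNReal.tsum_mul_left]
    refine ENNReal.tsum_le_tsum fun j ↦ ?_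
    refine (toSphere_directionSet_innerAnnulus_le hn hp E x₀ (j + 1)).trans ?_
    rw [directionConst_eq hn (by positivity), sub_self, Real.rpow_zero, inv_one, mul_one]
    gcongr
    -- The weight `i ^ (n - 1) ≥ 1` is simply discarded.
    exact le_mul_of_one_le_left zero_le (one_le_pow₀ (by simp))

theorem theorem3p3 (n : ℕ) (p : ℝ) (hp : 1 < p) (hpn : p ≤ n)
    (E : Set (EuclideanSpace ℝ (Fin n))) (x₀ : EuclideanSpace ℝ (Fin n))
    (hE : IsPThin p E x₀) :
    ∃ v : EuclideanSpace ℝ (Fin n), ‖v‖ = 1 ∧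
      ∃ r : ℝ, 0 < r ∧ openRay x₀ v ∩ Metric.ball x₀ r ∩ E = ∅ := by
  have hn : n ≠ 0 := by
    rintro rfl
    norm_num at hpn
    linarith
  have : Nonempty (Fin n) := ⟨⟨0, Nat.pos_of_ne_zero hn⟩⟩
  set σ := (volume : Measure (EuclideanSpace ℝ (Fin n))).toSphere
  have hσ : 0 < σ univ :=
    (Measure.measure_univ_ne_zero.2 (Measure.toSphere_ne_zero volume)).bot_lt
  have hlim := ENNReal.tendsto_sum_nat_add _ (hE.tsum_toSphere_directionSet_ne_top hn)
  obtain ⟨m, hm⟩ := (hlim.eventually_lt_const hσ).exists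
  have hlt : σ (⋃ k, directionSet x₀ (E ∩ innerAnnulus x₀ (k + m + 1))) < σ univ :=
    (measure_iUnion_le _).trans_lt hm
  obtain ⟨v, hv⟩ : ∃ v, v ∉ ⋃ k, directionSet x₀ (E ∩ innerAnnulus x₀ (k + m + 1)) := by
    by_contra! h
    exact hlt.ne (congrArg σ (eq_univ_of_forall h))
  refine ⟨v, by simp, (2 : ℝ) ^ (-((m + 1 : ℕ) : ℤ)), by positivity, ?_⟩
  rw [eq_empty_iff_forall_notMem]
  rintro _ ⟨⟨⟨t, ht, rfl⟩, htr⟩, htE⟩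
  have hnorm : ‖x₀ + t • (v : EuclideanSpace ℝ (Fin n)) - x₀‖ = t := by
    rw [add_sub_cancel_left, norm_smul, Real.norm_of_nonneg ht.le]
    simp
  rw [mem_ball, dist_eq_norm] at htr
  obtain ⟨k, hk⟩ := mem_innerAnnulus_of_norm (by rwa [hnorm]) htr
  exact hv (mem_iUnion.2 ⟨k, t, ht, htE, hk⟩)
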